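/- Let $R$ be a commutative noetherian ring with $1$ and let $I$ be an ideal of $R$. Write $\max(R)$ for the maximal spectrum of $R$ with the Zariski topology and $V(I)=\{\mathfrak m\in\max(R): I\subseteq\mathfrak m\}$. Let $n\ge 3$ and $d\ge 0$ be integers with $d\le 2n-3$, and suppose that $\max(R)$ is the disjoint union of $V(I)$ and of $V_1\cup\dots\cup V_k$, where $V_1,\dots,V_k\subseteq\max(R)$ are finitely many subsets (which may overlap), each of which is, in the subspace topology, a noetherian topological space of (Krull) dimension at most $d$. Let $\mathrm{Um}_n(R,I)$ be the set of rows $v=(v_1,\dots,v_n)\in R^n$ such that $v\cdot u^{t}=1$ for some $u\in R^n$ and $v\equiv(1,0,\dots,0)\pmod I$. Let $\mathrm E_n(R)\le\mathrm{GL}_n(R)$ be the subgroup generated by the elementary matrices $E_{ij}(\lambda)=I_n+\lambda e_{ij}$ ($i\ne j$, $\lambda\in R$), and let $\mathrm E_n(R,I)$ be the smallest normal subgroup of $\mathrm E_n(R)$ containing all $E_{21}(x)$ with $x\in I$. Then for all $v,w\in\mathrm{Um}_n(R,I)$ there are $\varepsilon_1,\varepsilon_2\in\mathrm E_n(R,I)$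 and $a,b,a_2,\dots,a_n\in R$ such that $$v\,\varepsilon_1=(a,a_2,a_3,\dots,a_n)\qquad\text{and}\qquad w\,\varepsilon_2=(b,a_2,a_3,\dots,a_n).$$ -/

import Mathlib

open scoped Matrix

/-- A row `v` of length `n` over `R` is unimodular if `v · wᵗ = 1` for some row `w`. -/
def IsUnimodularRow {R : Type*} [CommRing R] {n : ℕ} (v : Fin n → R) : Prop :=
  ∃ w : Fin n → R, v ⬝ᵥ w = 1

/-- `Um_n(R, I)`: the unimodular rows of length `n` that are congruent to `(1, 0, …, 0)` modulo
`I`. -/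
def Um {R : Type*} [CommRing R] (n : ℕ) (I : Ideal R) : Set (Fin n → R) :=
  {v | IsUnimodularRow v ∧ ∀ i : Fin n, v i - (if (i : ℕ) = 0 then 1 else 0) ∈ I}

/-- The elementary group `E_n(R)`: the subgroup of `GL_n(R)` generated by the elementary matrices
`E_{ij}(c) = 1 + c e_{ij}` with `i ≠ j` and `c ∈ R`. -/
def elemGroup (n : ℕ) (R : Type*) [CommRing R] : Subgroup (GL (Fin n) R) :=
  Subgroup.closure {g | ∃ i j : Fin n, i ≠ j ∧ ∃ c : R,
    (g : Matrix (Fin n) (Fin n) R) = Matrix.transvection i j c}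

/-- The relative elementary group `E_n(R, I)`: the smallest normal subgroup of `E_n(R)` that
contains the elementary matrices `E_{21}(x)` with `x ∈ I`, viewed as a subgroup of `GL_n(R)`.
(Coordinates are numbered from `0` in the code.) -/
def relElemGroup {R : Type*} [CommRing R] (n : ℕ) (I : Ideal R) : Subgroup (GL (Fin n) R) :=
  (Subgroup.normalClosure {g : elemGroup n R | ∃ i j : Fin n, (i : ℕ) = 1 ∧ (j : ℕ) = 0 ∧
    ∃ x ∈ I, ((g : GL (Fin n) R) : Matrix (Fin n) (Fin n) R) = Matrix.transvection i j x}).map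
      (elemGroup n R).subtype

/-- `V(I)` in the maximal spectrum: the set of the maximal ideals of `R` that contain `I`. -/
def maxZeroLocus {R : Type*} [CommRing R] (I : Ideal R) : Set (MaximalSpectrum R) :=
  {m | I ≤ m.asIdeal}

/-! ### General position on the maximal spectrum. -/

section TopologicalGeneralPosition

variable {R : Type*} [CommRing R]

/-! Write z for the first index and call the other n - 1 entries of a row its tail. If α v_z + β w_z
= 1 and D is the tail of w minus the tail of v, with entries in I, then adding v_z α D to the tail
of v and -w_z β D to that of w makes the tails equal. So it suffices to make the first entries
comaximal.

Adding multiples of tail entries to first entries achieves this if the two tails generate the unit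
ideal (`exists_isCoprime_add`). But both tails vanish on V(I). Hence v is traded for x = v
E_{zl}(1), whose entry x_l = v_l + v_z is 1 modulo I. This costs only a conjugation, under which the
relative group is stable (`exists_common_tail_of_isCoprime`).

The tails of x and w have 2n - 2 > d entries in all, so translating them by I-multiples of v_z and
w_z removes their common zeros outside V(I) (`exists_general_position`). -/

/-- The points of a subset of the maximal spectrum at which given ring elements all vanish. -/
def commonZeros {κ : Type*} (Y : Set (MaximalSpectrum R)) (s : Finset κ) (a : κ → R) : Set Y :=
  {y | ∀ i ∈ s, a i ∈ y.1.asIdeal}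

theorem isClosed_commonZeros {κ : Type*} (Y : Set (MaximalSpectrum R)) (s : Finset κ) (a : κ → R) :
    IsClosed (commonZeros Y s a) := by
  have h := (PrimeSpectrum.isClosed_zeroLocus (a '' (s : Set κ))).preimage
    (MaximalSpectrum.toPrimeSpectrum_continuous.comp (continuous_subtype_val (p := (· ∈ Y))))
  convert h using 1
  ext y
  simp [commonZeros, PrimeSpectrum.mem_zeroLocus, MaximalSpectrum.toPrimeSpectrum,
    Set.subset_def]

/-- An element can be translated by an element of an ideal so as to avoid finitely many maximal
ideals, none of which contains that ideal. -/
theorem exists_mem_add_notMem_of_finite (S : Set (MaximalSpectrum R)) (hS : S.Finite)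
    (B : Ideal R) (hB : ∀ m ∈ S, ¬ B ≤ m.asIdeal) (a : R) :
    ∃ c ∈ B, ∀ m ∈ S, a + c ∉ m.asIdeal := by
  have htop : B ⊔ ⨅ m ∈ hS.toFinset, m.asIdeal = ⊤ := by
    refine Ideal.sup_iInf_eq_top fun m hm => ?_
    rw [sup_comm]
    exact m.isMaximal.out.2 _ (left_lt_sup.2 (hB m (by simpa using hm)))
  -- Splitting 1 - a = c + x makes a + c = 1 - x a unit modulo every ideal in S.
  have hmem : 1 - a ∈ B ⊔ ⨅ m ∈ hS.toFinset, m.asIdeal := htop ▸ Submodule.mem_top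
  obtain ⟨c, hc, x, hx, hcx⟩ := Submodule.mem_sup.1 hmem
  refine ⟨c, hc, fun m hm h => m.isMaximal.ne_top ((Ideal.eq_top_iff_one _).2 ?_)⟩
  have hxm : x ∈ m.asIdeal := by
    simp only [Submodule.mem_iInf] at hx
    exact hx m (by simpa using hm)
  have := m.asIdeal.add_mem h hxm
  rwa [show a + c + x = 1 by linear_combination hcx] at this

/-- Each new index cuts the dimension by one: choose a point in each piece of a finite irreducible
closed cover of the zeros so far, and translate a_j off all these points. A chain of new zeros then
ends strictly inside a piece, which extends it. Bounding chains also covers the case where no zeros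
remain. -/
theorem exists_general_position_chain {ι κ : Type*} [Finite ι] (d : ℕ)
    (Y : ι → Set (MaximalSpectrum R))
    (hnoeth : ∀ k, TopologicalSpace.NoetherianSpace (Y k))
    (hdim : ∀ k, topologicalKrullDim (Y k) ≤ (d : WithBot ℕ∞))
    (a : κ → R) (B : κ → Ideal R) (hB : ∀ k, ∀ m ∈ Y k, ∀ i, ¬ B i ≤ m.asIdeal) (s : Finset κ) :
    ∃ c : κ → R, (∀ i, c i ∈ B i) ∧
      ∀ k, ∀ p : LTSeries (TopologicalSpace.IrreducibleCloseds (Y k)),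
        (p.last : Set (Y k)) ⊆ commonZeros (Y k) s (a + c) → p.length + s.card ≤ d := by
  classical
  induction s using Finset.induction_on with
  | empty =>
    refine ⟨0, fun i => (B i).zero_mem, fun k p _ => ?_⟩
    have := (Order.LTSeries.length_le_krullDim p).trans (hdim k)
    simpa using this
  | insert j s hj ih =>
    obtain ⟨c, hcB, hc⟩ := ih
    have hcomp : ∀ k, ∃ F : Set (Set (Y k)), F.Finite ∧ (∀ t ∈ F, IsClosed t) ∧
        (∀ t ∈ F, IsIrreducible t) ∧ commonZeros (Y k) s (a + c) = ⋃₀ F := fun k =>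
      have := hnoeth k
      TopologicalSpace.NoetherianSpace.exists_finite_set_isClosed_irreducible
        (isClosed_commonZeros (Y k) s (a + c))
    choose F hFfin hFcl hFirr hFU using hcomp
    choose pt hpt using fun k t (ht : t ∈ F k) => (hFirr k t ht).nonempty
    have hfin : ∀ k, Finite (F k) := fun k => hFfin k
    let S : Set (MaximalSpectrum R) :=
      Set.range fun x : Σ k, F k => ((pt x.1 x.2.1 x.2.2 : Y x.1) : MaximalSpectrum R)
    obtain ⟨e, heB, he⟩ := exists_mem_add_notMem_of_finite S (Set.finite_range _) (B j)
      (by rintro _ ⟨x, rfl⟩; exact hB x.1 _ (pt x.1 x.2.1 x.2.2).2 j) (a j)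
    have hs : ∀ i ∈ s, Function.update c j e i = c i := fun i hi =>
      Function.update_of_ne (fun h : i = j => hj (h ▸ hi)) _ _
    refine ⟨Function.update c j e, fun i => ?_, fun k p hp => ?_⟩
    · by_cases hij : i = j
      · subst hij; simpa using heB
      · simpa [hij] using hcB i
    · have hp' : (p.last : Set (Y k)) ⊆ commonZeros (Y k) s (a + c) := fun y hy i hi => by
        have := hp hy i (Finset.mem_insert_of_mem hi)
        rwa [Pi.add_apply, hs i hi] at this
      have hirr := p.last.isIrreducible
      obtain ⟨t, ht, hpt'⟩ := (isIrreducible_iff_sUnion_isClosed.1 hirr) (hFfin k).toFinset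
        (fun z hz => hFcl k z (by simpa using hz)) (by simpa [← hFU k] using hp')
      have ht' : t ∈ F k := by simpa using ht
      let T : TopologicalSpace.IrreducibleCloseds (Y k) := ⟨t, hFirr k t ht', hFcl k t ht'⟩
      have hlt : p.last < T := by
        refine lt_of_le_of_ne hpt' fun h => ?_
        have h1 : pt k t ht' ∈ (p.last : Set (Y k)) := by rw [h]; exact hpt k t ht'
        have h2 := hp h1 j (Finset.mem_insert_self _ _)
        rw [Pi.add_apply, Function.update_self] at h2
        exact he _ ⟨⟨k, t, ht'⟩, rfl⟩ h2
      have := hc k (p.snoc T hlt) (by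
        rw [RelSeries.last_snoc, hFU k]
        exact Set.subset_sUnion_of_mem ht')
      rw [RelSeries.snoc_length] at this
      rw [Finset.card_insert_of_notMem hj]
      omega

/-- General position: on a finite union of noetherian subspaces of dimension at most `d`, more than
`d` elements can be translated by elements of prescribed nowhere vanishing ideals so that they have
no common zero. -/
theorem exists_general_position {ι κ : Type*} [Finite ι] [Fintype κ] (d : ℕ)
    (hd : d < Fintype.card κ) (Y : ι → Set (MaximalSpectrum R))
    (hnoeth : ∀ k, TopologicalSpace.NoetherianSpace (Y k))
    (hdim : ∀ k, topologicalKrullDim (Y k) ≤ (d : WithBot ℕ∞))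
    (a : κ → R) (B : κ → Ideal R) (hB : ∀ k, ∀ m ∈ Y k, ∀ i, ¬ B i ≤ m.asIdeal) :
    ∃ c : κ → R, (∀ i, c i ∈ B i) ∧ ∀ k, ∀ m ∈ Y k, ∃ i, a i + c i ∉ m.asIdeal := by
  obtain ⟨c, hcB, hc⟩ := exists_general_position_chain d Y hnoeth hdim a B hB Finset.univ
  refine ⟨c, hcB, fun k m hm => ?_⟩
  by_contra! h
  -- A common zero is a closed point, hence a chain of length 0, and the bound would give
  -- `Fintype.card κ ≤ d`.
  have := hc k (RelSeries.singleton _ ({⟨m, hm⟩} : TopologicalSpace.IrreducibleCloseds (Y k))) (by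
    rintro y hy i -
    obtain rfl : y = ⟨m, hm⟩ := by simpa using hy
    exact h i)
  rw [Finset.card_univ] at this
  omega

end TopologicalGeneralPosition

/-! ### The relative elementary group and its action on rows. -/

section ElementaryGroup

open Matrix

variable {R : Type*} [CommRing R] {n : ℕ}

/-- The elementary matrix `1 + c e_{ij}` as an element of the general linear group. -/
def elemGL {i j : Fin n} (h : i ≠ j) (c : R) : GL (Fin n) R :=
  (SpecialLinearGroup.transvection h c : SpecialLinearGroup (Fin n) R)

theorem coe_elemGL {i j : Fin n} (h : i ≠ j) (c : R) :
    ((elemGL h c : GL (Fin n) R) : Matrix (Fin n) (Fin n) R) = transvection i j c := rfl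

theorem elemGL_inv {i j : Fin n} (h : i ≠ j) (c : R) : (elemGL h c)⁻¹ = elemGL h (-c) := by
  rw [inv_eq_iff_mul_eq_one]
  ext1
  simp [coe_elemGL, transvection_mul_transvection_same _ _ h]

theorem elemGL_mem_elemGroup {i j : Fin n} (h : i ≠ j) (c : R) : elemGL h c ∈ elemGroup n R :=
  Subgroup.subset_closure ⟨i, j, h, c, rfl⟩

theorem elemGL_commutator {i j k : Fin n} (hij : i ≠ j) (hjk : j ≠ k) (hik : i ≠ k) (a b : R) :
    elemGL hij a * elemGL hjk b * (elemGL hij a)⁻¹ * (elemGL hjk b)⁻¹ = elemGL hik (a * b) := by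
  rw [elemGL_inv, elemGL_inv]
  ext1
  simp only [Units.val_mul, coe_elemGL, transvection]
  simp [mul_add, add_mul, hij.symm, hjk.symm, hik.symm, ← single_neg]
  abel

theorem vecMul_elemGL {i j : Fin n} (h : i ≠ j) (c : R) (v : Fin n → R) :
    v ᵥ* (elemGL h c : Matrix (Fin n) (Fin n) R) = v + Pi.single j (v i * c) := by
  rw [coe_elemGL, transvection, vecMul_add, vecMul_one]
  congr 1
  ext k
  by_cases hk : j = k
  · subst hk; simp [vecMul, dotProduct, single_apply]
  · simp [vecMul, dotProduct, hk, Ne.symm hk]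

theorem conj_mem_relElemGroup {I : Ideal R} {g e : GL (Fin n) R} (hg : g ∈ relElemGroup n I)
    (he : e ∈ elemGroup n R) : e * g * e⁻¹ ∈ relElemGroup n I := by
  rw [relElemGroup, Subgroup.mem_map] at hg ⊢
  obtain ⟨x, hx, hxg⟩ := hg
  refine ⟨_, Subgroup.normalClosure_normal.conj_mem x hx ⟨e, he⟩, ?_⟩
  rw [map_mul, map_mul, map_inv, hxg, Subgroup.subtype_apply]

theorem elemGL_mem_relElemGroup_row {I : Ideal R} {i j k : Fin n} (hij : i ≠ j) (hjk : j ≠ k)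
    (hik : i ≠ k) {x : R} (h : elemGL hjk x ∈ relElemGroup n I) :
    elemGL hik x ∈ relElemGroup n I := by
  rw [← one_mul x, ← elemGL_commutator hij hjk hik 1 x]
  exact mul_mem (conj_mem_relElemGroup h (elemGL_mem_elemGroup hij 1)) (inv_mem h)

theorem elemGL_mem_relElemGroup_col {I : Ideal R} {i j k : Fin n} (hij : i ≠ j) (hjk : j ≠ k)
    (hik : i ≠ k) {x : R} (h : elemGL hij x ∈ relElemGroup n I) :
    elemGL hik x ∈ relElemGroup n I := by
  rw [← mul_one x, ← elemGL_commutator hij hjk hik x 1, mul_assoc, mul_assoc,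
    ← mul_assoc (elemGL hjk 1)]
  exact mul_mem h (conj_mem_relElemGroup (inv_mem h) (elemGL_mem_elemGroup hjk 1))

/-- Commutators with E_{ij}(1) move the row and column indices of the generator E_{21}(x) one at a
time. Row z comes last, by way of a third index. -/
theorem elemGL_mem_relElemGroup (hn : 3 ≤ n) {I : Ideal R} {i j : Fin n} (h : i ≠ j) {x : R}
    (hx : x ∈ I) : elemGL h x ∈ relElemGroup n I := by
  let z : Fin n := ⟨0, by omega⟩
  let o : Fin n := ⟨1, by omega⟩
  have hoz : o ≠ z := by simp [o, z, Fin.ext_iff]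
  have hbase : elemGL hoz x ∈ relElemGroup n I :=
    ⟨⟨_, elemGL_mem_elemGroup hoz x⟩, Subgroup.subset_normalClosure ⟨o, z, rfl, rfl, x, hx, rfl⟩,
      rfl⟩
  have hcol : ∀ {k : Fin n} (hk : k ≠ z), elemGL hk x ∈ relElemGroup n I := fun {k} hk => by
    by_cases hko : k = o
    · subst hko; exact hbase
    · exact elemGL_mem_relElemGroup_row hko hoz hk hbase
  have hrow : ∀ {k l : Fin n} (_ : k ≠ z) (hkl : k ≠ l), elemGL hkl x ∈ relElemGroup n I :=
    fun {k l} hk hkl => by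
      by_cases hl : l = z
      · subst hl; exact hcol hk
      · exact elemGL_mem_relElemGroup_col hk (Ne.symm hl) hkl (hcol hk)
  by_cases hi : i = z
  · obtain ⟨k, hki, hkj⟩ : ∃ k : Fin n, k ≠ i ∧ k ≠ j := by
      obtain ⟨k, hk⟩ := Finset.exists_mem_notMem_of_card_lt_card (s := {i, j})
        (t := (Finset.univ : Finset (Fin n)))
        (lt_of_le_of_lt Finset.card_le_two (by simp; omega))
      exact ⟨k, by simpa using hk⟩
    exact elemGL_mem_relElemGroup_row hki.symm hkj h (hrow (hi ▸ hki) hkj)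
  · exact hrow hi h

/-- Multiples of the entry with index `z` by elements of `I` may be added to the other entries. -/
theorem exists_relElemGroup_add_mul (hn : 3 ≤ n) {I : Ideal R} (z : Fin n) (c : Fin n → R)
    (hc : ∀ i, c i ∈ I) :
    ∃ ε ∈ relElemGroup n I, ∀ v : Fin n → R, ∀ i,
      (v ᵥ* (ε : Matrix (Fin n) (Fin n) R)) i = if i = z then v i else v i + v z * c i := by
  suffices ∀ s : Finset (Fin n), z ∉ s → ∃ ε ∈ relElemGroup n I, ∀ v : Fin n → R, ∀ i,
      (v ᵥ* (ε : Matrix (Fin n) (Fin n) R)) i = if i ∈ s then v i + v z * c i else v i by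
    obtain ⟨ε, hε, h⟩ := this (Finset.univ.erase z) (by simp)
    exact ⟨ε, hε, fun v i => by rw [h]; by_cases hi : i = z <;> simp [hi]⟩
  intro s
  induction s using Finset.induction_on with
  | empty => exact fun _ => ⟨1, one_mem _, by simp⟩
  | insert j s hj ih =>
    intro hz
    rw [Finset.mem_insert, not_or] at hz
    obtain ⟨ε, hε, h⟩ := ih hz.2
    refine ⟨ε * elemGL hz.1 (c j), mul_mem hε (elemGL_mem_relElemGroup hn hz.1 (hc j)),
      fun v i => ?_⟩
    rw [Units.val_mul, ← vecMul_vecMul, vecMul_elemGL, Pi.add_apply, h, h, if_neg hz.2]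
    by_cases hij : i = j
    · subst hij; simp [hj]
    · simp [hij]

/-- Multiples of the other entries by elements of `I` may be added to the entry with index `z`. -/
theorem exists_relElemGroup_add_sum (hn : 3 ≤ n) {I : Ideal R} (z : Fin n) (c : Fin n → R)
    (hc : ∀ i, c i ∈ I) :
    ∃ ε ∈ relElemGroup n I, ∀ v : Fin n → R,
      v ᵥ* (ε : Matrix (Fin n) (Fin n) R) =
        v + Pi.single z (∑ i ∈ Finset.univ.erase z, v i * c i) := by
  suffices ∀ s : Finset (Fin n), z ∉ s → ∃ ε ∈ relElemGroup n I, ∀ v : Fin n → R,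
      v ᵥ* (ε : Matrix (Fin n) (Fin n) R) = v + Pi.single z (∑ i ∈ s, v i * c i) from
    this _ (by simp)
  intro s
  induction s using Finset.induction_on with
  | empty => exact fun _ => ⟨1, one_mem _, by simp⟩
  | insert j s hj ih =>
    intro hz
    rw [Finset.mem_insert, not_or] at hz
    obtain ⟨ε, hε, h⟩ := ih hz.2
    refine ⟨ε * elemGL (Ne.symm hz.1) (c j),
      mul_mem hε (elemGL_mem_relElemGroup hn (Ne.symm hz.1) (hc j)), fun v => ?_⟩
    rw [Units.val_mul, ← vecMul_vecMul, vecMul_elemGL, h, Finset.sum_insert hj, Pi.single_add,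
      Pi.add_apply, Pi.single_eq_of_ne (Ne.symm hz.1)]
    simp only [add_zero]
    abel

end ElementaryGroup

/-! ### From comaximal tails to equal tails. -/

section CommonTail

open Matrix

variable {R : Type*} [CommRing R] {n : ℕ}

/-- If `J` is comaximal to both `I` and `K`, and `y ≡ 1` modulo `I`, then `x` and `y` become
comaximal after translation by elements of `I * J` and `I * K`. -/
theorem exists_isCoprime_add {I J K : Ideal R} (hJI : IsCoprime J I) (hJK : IsCoprime J K)
    (x : R) {y : R} (hy : y - 1 ∈ I) :
    ∃ j ∈ I * J, ∃ k ∈ I * K, IsCoprime (x + j) (y + k) := by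
  obtain ⟨e, he, k, hk, hek⟩ := Ideal.isCoprime_iff_exists.1 (hJI.mul_right hJK)
  have hkI : k ∈ I := Ideal.mul_le_left hk
  -- The element q = y + k(1 - y) is 1 modulo I because y is, and 1 modulo J because k is.
  have hqI : IsCoprime (Ideal.span {y + k * (1 - y)}) I := by
    refine Ideal.isCoprime_iff_exists.2 ⟨_, Ideal.mem_span_singleton_self _, -(y - 1) * (1 - k),
      I.mul_mem_right _ (I.neg_mem hy), ?_⟩
    ring
  have hqJ : IsCoprime (Ideal.span {y + k * (1 - y)}) J := by
    refine Ideal.isCoprime_iff_exists.2 ⟨_, Ideal.mem_span_singleton_self _, e * (1 - y),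
      J.mul_mem_right _ he, ?_⟩
    linear_combination (1 - y) * hek
  obtain ⟨s, hs, f, hf, hsf⟩ := Ideal.isCoprime_iff_exists.1 (hqI.mul_right hqJ)
  obtain ⟨r, rfl⟩ := Ideal.mem_span_singleton'.1 hs
  -- From f + rq = 1 follows x + f(1 - x) = 1 - rq(1 - x).
  refine ⟨f * (1 - x), Ideal.mul_mem_right _ _ hf, k * (1 - y), Ideal.mul_mem_right _ _ hk,
    1, r * (1 - x), ?_⟩
  linear_combination (1 - x) * hsf

theorem IsUnimodularRow.exists_notMem {v : Fin n → R} (hv : IsUnimodularRow v) {m : Ideal R}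
    (hm : m ≠ ⊤) : ∃ i, v i ∉ m := by
  obtain ⟨u, hu⟩ := hv
  by_contra! h
  refine hm ((Ideal.eq_top_iff_one m).2 (hu ▸ ?_))
  exact Submodule.sum_mem _ fun i _ => m.mul_mem_right _ (h i)

theorem IsUnimodularRow.vecMul {v : Fin n → R} (hv : IsUnimodularRow v) (g : GL (Fin n) R) :
    IsUnimodularRow (v ᵥ* (g : Matrix (Fin n) (Fin n) R)) := by
  obtain ⟨u, hu⟩ := hv
  refine ⟨((g⁻¹ : GL (Fin n) R) : Matrix (Fin n) (Fin n) R) *ᵥ u, ?_⟩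
  rw [dotProduct_mulVec, vecMul_vecMul, ← Units.val_mul, mul_inv_cancel, Units.val_one, vecMul_one,
    hu]

/-- The ideal generated by the entries of a row other than the one with index `z`. -/
def tailIdeal (z : Fin n) (x : Fin n → R) : Ideal R :=
  Ideal.span (x '' (Finset.univ.erase z : Finset (Fin n)))

theorem mem_tailIdeal {z i : Fin n} (h : i ≠ z) (x : Fin n → R) : x i ∈ tailIdeal z x :=
  Ideal.subset_span ⟨i, by simpa using h, rfl⟩

theorem exists_sum_of_mem_mul_tailIdeal {I : Ideal R} {z : Fin n} {x : Fin n → R} {y : R}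
    (h : y ∈ I * tailIdeal z x) :
    ∃ c : Fin n → R, (∀ i, c i ∈ I) ∧ y = ∑ i ∈ Finset.univ.erase z, x i * c i := by
  induction h using Submodule.mul_induction_on' with
  | mem_mul_mem a ha b hb =>
    obtain ⟨c, rfl⟩ := (Submodule.mem_span_image_finset_iff_exists_fun' R).1 hb
    refine ⟨fun i => a * c i, fun i => I.mul_mem_right _ ha, ?_⟩
    rw [Finset.mul_sum]
    exact Finset.sum_congr rfl fun i _ => by rw [smul_eq_mul]; ring
  | add a _ b _ ha hb =>
    obtain ⟨c, hc, rfl⟩ := ha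
    obtain ⟨e, he, rfl⟩ := hb
    exact ⟨c + e, fun i => I.add_mem (hc i) (he i), by simp [mul_add, Finset.sum_add_distrib]⟩

/-- Rows whose tails, after changing one of them at `V(I)`, have no common zero can be moved into
rows with equal tails. -/
theorem exists_common_tail_of_isCoprime (hn : 3 ≤ n) {I : Ideal R} {z l : Fin n} (hlz : l ≠ z)
    {v w : Fin n → R} (hv : ∀ i, v i - (if i = z then 1 else 0) ∈ I)
    (hw : ∀ i, w i - (if i = z then 1 else 0) ∈ I)
    (h : IsCoprime (tailIdeal z (v + Pi.single l (v z))) (tailIdeal z w)) :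
    ∃ ε₁ ∈ relElemGroup n I, ∃ ε₂ ∈ relElemGroup n I, ∀ i, i ≠ z →
      (v ᵥ* (ε₁ : Matrix (Fin n) (Fin n) R)) i = (w ᵥ* (ε₂ : Matrix (Fin n) (Fin n) R)) i := by
  set x := v + Pi.single l (v z) with hx
  have hvz : v z - 1 ∈ I := by simpa using hv z
  have hwz : w z - 1 ∈ I := by simpa using hw z
  have hvi : ∀ i, i ≠ z → v i ∈ I := fun i hi => by simpa [hi] using hv i
  have hwi : ∀ i, i ≠ z → w i ∈ I := fun i hi => by simpa [hi] using hw i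
  have hJI : IsCoprime (tailIdeal z x) I := by
    refine Ideal.isCoprime_iff_exists.2 ⟨x l, mem_tailIdeal hlz x, -(v l + (v z - 1)),
      I.neg_mem (I.add_mem (hvi l hlz) hvz), ?_⟩
    simp only [hx, Pi.add_apply, Pi.single_eq_same]
    ring
  obtain ⟨j, hj, k, hk, α, β, hαβ⟩ := exists_isCoprime_add hJI h (v z) hwz
  obtain ⟨c, hc, hjc⟩ := exists_sum_of_mem_mul_tailIdeal hj
  obtain ⟨e, he, hke⟩ := exists_sum_of_mem_mul_tailIdeal hk
  obtain ⟨A, hA, hAv⟩ := exists_relElemGroup_add_sum hn z c hc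
  obtain ⟨B, hB, hBw⟩ := exists_relElemGroup_add_sum hn z e he
  -- The conjugate passes from v to x, adds j to the entry at z, and passes back; the return leaves
  -- -j at l.
  have hg := conj_mem_relElemGroup hA (elemGL_mem_elemGroup hlz.symm (1 : R))
  set g := elemGL hlz.symm (1 : R) * A * (elemGL hlz.symm (1 : R))⁻¹ with hgdef
  have hxz : x z = v z := by simp [hx, hlz.symm]
  have hvg : v ᵥ* (g : Matrix (Fin n) (Fin n) R) = v + Pi.single z j - Pi.single l j := by
    rw [hgdef, elemGL_inv, Units.val_mul, Units.val_mul, ← vecMul_vecMul, ← vecMul_vecMul,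
      vecMul_elemGL, vecMul_elemGL, mul_one, ← hx, hAv, ← hjc, Pi.add_apply, hxz,
      Pi.single_eq_same, hx, mul_neg, mul_one, Pi.single_neg, Pi.single_add]
    abel
  have hwB : w ᵥ* (B : Matrix (Fin n) (Fin n) R) = w + Pi.single z k := by rw [hBw, ← hke]
  clear_value g
  set v' := v ᵥ* (g : Matrix (Fin n) (Fin n) R)
  set w' := w ᵥ* (B : Matrix (Fin n) (Fin n) R)
  have hv'z : v' z = v z + j := by simp [hvg, hlz.symm]
  have hw'z : w' z = w z + k := by simp [hwB]
  have hjI : j ∈ I := Ideal.mul_le_left hj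
  have hdiff : ∀ i, i ≠ z → w' i - v' i ∈ I := fun i hi => by
    refine I.sub_mem ?_ ?_
    · simpa [hwB, hi] using hwi i hi
    · have : v' i = v i - (Pi.single l j : Fin n → R) i := by simp [hvg, hi]
      rw [this]
      refine I.sub_mem (hvi i hi) ?_
      by_cases hil : i = l
      · subst hil; simpa using hjI
      · simp [hil]
  let D : Fin n → R := fun i => if i = z then 0 else w' i - v' i
  have hD : ∀ i, D i ∈ I := fun i => by
    by_cases hi : i = z
    · simp [D, hi]
    · simpa [D, hi] using hdiff i hi
  obtain ⟨P, hP, hPv⟩ := exists_relElemGroup_add_mul hn z (fun i => α * D i)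
    fun i => I.mul_mem_left _ (hD i)
  obtain ⟨Q, hQ, hQw⟩ := exists_relElemGroup_add_mul hn z (fun i => -β * D i)
    fun i => I.mul_mem_left _ (hD i)
  refine ⟨g * P, mul_mem hg hP, B * Q, mul_mem hB hQ, fun i hi => ?_⟩
  rw [Units.val_mul, Units.val_mul, ← vecMul_vecMul, ← vecMul_vecMul, hPv, hQw, if_neg hi,
    if_neg hi]
  change v' i + v' z * (α * D i) = w' i + w' z * (-β * D i)
  rw [hv'z, hw'z]
  simp only [D, if_neg hi]
  linear_combination (w' i - v' i) * hαβ

/-- In general position, the tails of two rows have no common zero. -/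
theorem exists_relElemGroup_isCoprime_tailIdeal (I : Ideal R) (d : ℕ)
    (hn : 3 ≤ n) (hd : d ≤ 2 * n - 3) {ι : Type*} [Finite ι] (V : ι → Set (MaximalSpectrum R))
    (hV : (⋃ i, V i) = (maxZeroLocus I)ᶜ) (hnoeth : ∀ i, TopologicalSpace.NoetherianSpace (V i))
    (hdim : ∀ i, topologicalKrullDim (V i) ≤ (d : WithBot ℕ∞)) {z l : Fin n} (hlz : l ≠ z)
    {v w : Fin n → R} (hvI : ∀ i, v i - (if i = z then 1 else 0) ∈ I) :
    ∃ c e : Fin n → R, (∀ i, c i ∈ I) ∧ (∀ i, e i ∈ I) ∧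
      ∀ v' w' : Fin n → R, (∀ i, v' i = if i = z then v i else v i + v z * c i) →
        (∀ i, w' i = if i = z then w i else w i + w z * e i) →
        IsUnimodularRow v' → IsUnimodularRow w' →
        IsCoprime (tailIdeal z (v' + Pi.single l (v' z))) (tailIdeal z w') := by
  -- At zeros of v_z or w_z the translating ideals vanish, so these points are left out;
  -- unimodularity excludes them as common zeros below.
  let Y : ι → Set (MaximalSpectrum R) := fun i =>
    {m | m ∈ V i ∧ v z ∉ m.asIdeal ∧ w z ∉ m.asIdeal}
  have hYV : ∀ i, Y i ⊆ V i := fun i m hm => hm.1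
  have hind : ∀ i, Topology.IsInducing (Set.inclusion (hYV i)) := fun i =>
    (Topology.IsEmbedding.inclusion (hYV i)).isInducing
  let κ := {i : Fin n // i ≠ z} ⊕ {i : Fin n // i ≠ z}
  have hκ : d < Fintype.card κ := by
    rw [Fintype.card_sum, Fintype.card_subtype_compl, Fintype.card_subtype_eq, Fintype.card_fin]
    omega
  have hVI : ∀ i, ∀ m ∈ V i, ¬ I ≤ m.asIdeal := fun i m hm => by
    have : m ∈ (maxZeroLocus I)ᶜ := hV ▸ Set.mem_iUnion.2 ⟨i, hm⟩
    exact this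
  obtain ⟨b, hbB, hb⟩ := exists_general_position d hκ Y
    (fun i => have := hnoeth i; (hind i).noetherianSpace)
    (fun i => (hind i).topologicalKrullDim_le.trans (hdim i))
    (Sum.elim (fun i => (v + Pi.single l (v z) : Fin n → R) i.1) (fun i => w i.1) : κ → R)
    (Sum.elim (fun _ => I * Ideal.span {v z}) (fun _ => I * Ideal.span {w z}))
    (by
      rintro i m ⟨hmV, hmv, hmw⟩ (j | j) h <;>
      · rcases m.isMaximal.isPrime.mul_le.1 h with h | h
        · exact hVI i m hmV h
        · rw [Ideal.span_singleton_le_iff_mem] at h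
          contradiction)
  have hc : ∀ i, ∃ r ∈ I, ∀ h : i ≠ z, v z * r = b (Sum.inl ⟨i, h⟩) := fun i => by
    by_cases h : i = z
    · exact ⟨0, I.zero_mem, fun h' => absurd h h'⟩
    · obtain ⟨r, hr, hrb⟩ := Ideal.mem_mul_span_singleton.1 (hbB (Sum.inl ⟨i, h⟩))
      exact ⟨r, hr, fun _ => (mul_comm _ _).trans hrb⟩
  have he : ∀ i, ∃ r ∈ I, ∀ h : i ≠ z, w z * r = b (Sum.inr ⟨i, h⟩) := fun i => by
    by_cases h : i = z
    · exact ⟨0, I.zero_mem, fun h' => absurd h h'⟩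
    · obtain ⟨r, hr, hrb⟩ := Ideal.mem_mul_span_singleton.1 (hbB (Sum.inr ⟨i, h⟩))
      exact ⟨r, hr, fun _ => (mul_comm _ _).trans hrb⟩
  choose c hcI hcb using hc
  choose e heI heb using he
  refine ⟨c, e, hcI, heI, fun v' w' hv' hw' huv huw => ?_⟩
  have hv'z : v' z = v z := by simp [hv']
  have hw'z : w' z = w z := by simp [hw']
  rw [Ideal.isCoprime_iff_sup_eq]
  by_contra hne
  obtain ⟨m, hm, hle⟩ := Ideal.exists_le_maximal _ hne
  have hxm : ∀ i, i ≠ z → (v' + Pi.single l (v' z) : Fin n → R) i ∈ m := fun i hi =>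
    hle (Ideal.mem_sup_left (mem_tailIdeal hi _))
  have hwm : ∀ i, i ≠ z → w' i ∈ m := fun i hi => hle (Ideal.mem_sup_right (mem_tailIdeal hi _))
  have hwz : w z ∉ m := fun h => by
    obtain ⟨i, hi⟩ := huw.exists_notMem hm.ne_top
    by_cases hiz : i = z
    · exact hi (by rw [hiz, hw'z]; exact h)
    · exact hi (hwm i hiz)
  have hvz : v z ∉ m := fun h => by
    obtain ⟨i, hi⟩ := huv.exists_notMem hm.ne_top
    by_cases hiz : i = z
    · exact hi (by rw [hiz, hv'z]; exact h)
    · refine hi ?_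
      have := hxm i hiz
      by_cases hil : i = l
      · subst hil
        simp only [Pi.add_apply, Pi.single_eq_same, hv'z] at this
        exact (m.add_mem_iff_left h).1 this
      · simpa [hil] using this
  -- Modulo I the entry at l of the shifted row is v_l + v_z = 1.
  have hIm : ¬ I ≤ m := fun hI => by
    refine hm.ne_top ((Ideal.eq_top_iff_one m).2 ?_)
    have h1 : v l ∈ m := hI (by simpa [hlz] using hvI l)
    have h2 : v z - 1 ∈ m := hI (by simpa using hvI z)
    have h3 := hxm l hlz
    simp only [Pi.add_apply, Pi.single_eq_same, hv'z, hv' l, if_neg hlz] at h3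
    have h4 : v z * c l ∈ m := m.mul_mem_left _ (hI (hcI l))
    have := m.sub_mem (m.sub_mem (m.sub_mem h3 h1) h4) h2
    rwa [show v l + v z * c l + v z - v l - v z * c l - (v z - 1) = 1 by ring] at this
  have hmV : (⟨m, hm⟩ : MaximalSpectrum R) ∈ ⋃ i, V i := hV ▸ hIm
  obtain ⟨k, hk⟩ := Set.mem_iUnion.1 hmV
  obtain ⟨i | i, hi⟩ := hb k ⟨m, hm⟩ ⟨hk, hvz, hwz⟩
  · refine hi ?_
    have := hxm i.1 i.2
    simp only [Pi.add_apply, hv'z, hv' i.1, if_neg i.2, hcb i.1 i.2] at this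
    simpa only [Sum.elim_inl, Pi.add_apply, add_right_comm] using this
  · refine hi ?_
    have := hwm i.1 i.2
    rwa [hw' i.1, if_neg i.2, heb i.1 i.2] at this

end CommonTail

theorem mainTheorem10 {R : Type*} [CommRing R] [IsNoetherianRing R] (I : Ideal R) (n d : ℕ)
    (hn : 3 ≤ n) (hd : d ≤ 2 * n - 3)
    {ι : Type*} [Finite ι] (V : ι → Set (MaximalSpectrum R))
    (hV : (⋃ i, V i) = (maxZeroLocus I)ᶜ)
    (hnoeth : ∀ i, TopologicalSpace.NoetherianSpace (V i))
    (hdim : ∀ i, topologicalKrullDim (V i) ≤ (d : WithBot ℕ∞))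
    (v w : Fin n → R) (hv : v ∈ Um n I) (hw : w ∈ Um n I) :
    ∃ ε₁ ∈ relElemGroup n I, ∃ ε₂ ∈ relElemGroup n I, ∃ (a b : R) (t : Fin n → R),
      (∀ i : Fin n, (v ᵥ* (ε₁ : Matrix (Fin n) (Fin n) R)) i = if (i : ℕ) = 0 then a else t i) ∧
      (∀ i : Fin n, (w ᵥ* (ε₂ : Matrix (Fin n) (Fin n) R)) i = if (i : ℕ) = 0 then b else t i) := by
  let z : Fin n := ⟨0, by omega⟩
  have hlz : (⟨1, by omega⟩ : Fin n) ≠ z := by simp [z]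
  have hz : ∀ i : Fin n, (i : ℕ) = 0 ↔ i = z := fun i => by simp [z, Fin.ext_iff]
  simp only [Um, hz, Set.mem_ofPred_eq] at hv hw ⊢
  have hmem : ∀ {u c u' : Fin n → R}, (∀ i, u i - (if i = z then 1 else 0) ∈ I) →
      (∀ i, c i ∈ I) → (∀ i, u' i = if i = z then u i else u i + u z * c i) →
      ∀ i, u' i - (if i = z then 1 else 0) ∈ I := fun {u c u'} hu hc hu' i => by
    rw [hu']
    by_cases hi : i = z
    · simpa [hi] using hu z
    · simpa [hi] using I.add_mem (by simpa [hi] using hu i) (I.mul_mem_left (u z) (hc i))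
  obtain ⟨c, e, hc, he, hce⟩ := exists_relElemGroup_isCoprime_tailIdeal I d hn hd V hV hnoeth hdim
    hlz hv.2 (w := w)
  obtain ⟨A, hA, hAv⟩ := exists_relElemGroup_add_mul hn z c hc
  obtain ⟨B, hB, hBw⟩ := exists_relElemGroup_add_mul hn z e he
  obtain ⟨P, hP, Q, hQ, hPQ⟩ := exists_common_tail_of_isCoprime hn hlz
    (hmem hv.2 hc (hAv v)) (hmem hw.2 he (hBw w))
    (hce _ _ (hAv v) (hBw w) (hv.1.vecMul A) (hw.1.vecMul B))
  simp only [Matrix.vecMul_vecMul, ← Units.val_mul] at hPQ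
  -- The value of `t` at z is never read, so the whole moved row can serve.
  refine ⟨A * P, mul_mem hA hP, B * Q, mul_mem hB hQ,
    (v ᵥ* ((A * P : GL (Fin n) R) : Matrix (Fin n) (Fin n) R)) z,
    (w ᵥ* ((B * Q : GL (Fin n) R) : Matrix (Fin n) (Fin n) R)) z,
    v ᵥ* ((A * P : GL (Fin n) R) : Matrix (Fin n) (Fin n) R), fun i => ?_, fun i => ?_⟩
  · by_cases hi : i = z <;> simp [hi]
  · by_cases hi : i = z
    · simp [hi]
    · rw [if_neg hi, hPQ i hi]
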